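/- Let $F$ be an algebraically closed field of characteristic $0$, let $m\ge 2$ be an integer and let $\zeta\in F$ be a primitive $m$-th root of unity. Let $H=H_{m^2}(\zeta)$ be the Taft algebra, i.e. the unital $F$-algebra generated by $c,v$ with relations $c^m=1$, $v^m=0$, $vc=\zeta cv$, with comultiplication $\Delta(c)=c\otimes c$, $\Delta(v)=c\otimes v+v\otimes 1$ and counit $\varepsilon(c)=1$, $\varepsilon(v)=0$. An $H$-module Lie algebra is a Lie algebra $L$ over $F$ that is a left $H$-module with $h[a,b]=[h_{(1)}a,h_{(2)}b]$ for all $h\in H$, $a,b\in L$ (where $\Delta h=h_{(1)}\otimes h_{(2)}$ in Sweedler's notation); it is $H$-simple if $[L,L]\ne 0$ and $0$ and $L$ are its only $H$-invariant ideals. Put $L^{(0)}=\{a\in L\mid ca=a\}$. For a Lie algebra $B$ over $F$, let $L(B,0)=\bigoplus_{i=0}^{m-1}\varphi^i(B)$, where $\varphi^0(B)=B$ and each $\varphi^i(B)$ is a copy of the vector space $B$ via a linear bijection $a\mapsto\varphi^i(a)$, with the $H$-action $c\,\varphi^i(a)=\zeta^i\varphi^i(a)$, $v\,\varphi^{i}(a)=\varphi^{i-1}(a)$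 for $1\le i\le m-1$, $v\,\varphi^0(a)=0$, and with the bracket $$[\varphi^k(a),\varphi^\ell(b)]=\begin{cases}\binom{k+\ell}{k}_\zeta\,\varphi^{k+\ell}([a,b]) & \text{if } k+\ell<m,\\ 0 & \text{if } k+\ell\ge m,\end{cases}\qquad a,b\in B,\ 0\le k,\ell<m,$$ where $\binom{n}{k}_\zeta=\frac{n!_\zeta}{(n-k)!_\zeta\,k!_\zeta}$, $n!_\zeta=\prod_{j=1}^n(1+\zeta+\dots+\zeta^{j-1})$. Theorem. Let $L$ be a finite dimensional $H$-simple $H$-module Lie algebra over $F$ whose solvable radical is nonzero. Then there is a finite dimensional simple Lie algebra $B$ over $F$ such that $L$ is isomorphic to $L(B,0)$ as an $H$-module algebra (that is, by an isomorphism of Lie algebras that commutes with the action of $H$), and $L^{(0)}\cong B$ as Lie algebras. Moreover, the solvable radical of $L$ equals its nilpotent radical (the largest nilpotent ideal), and $\{x\in L\mid vx=0\}=L^{(0)}$. -/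

import Mathlib

universe u w

open scoped TensorProduct

noncomputable section

/-! ### Quantum integers, factorials and binomial coefficients -/

section Quantum

variable {F : Type*} [Field F]

/-- The quantum factorial `n!_ζ = n_ζ (n-1)_ζ ⋯ 1_ζ`, where `k_ζ = 1 + ζ + ⋯ + ζ ^ (k-1)`. -/
def qFactorial (ζ : F) (n : ℕ) : F :=
  ∏ j ∈ Finset.range n, ∑ i ∈ Finset.range (j + 1), ζ ^ i

/-- The quantum binomial coefficient `n!_ζ / ((n-k)!_ζ k!_ζ)`. -/
def qBinom (ζ : F) (n k : ℕ) : F :=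
  qFactorial ζ n / (qFactorial ζ (n - k) * qFactorial ζ k)

theorem qFactorial_succ (ζ : F) (n : ℕ) :
    qFactorial ζ (n + 1) = qFactorial ζ n * ∑ i ∈ Finset.range (n + 1), ζ ^ i :=
  Finset.prod_range_succ _ _

theorem qFactorial_ne_zero {ζ : F} {m : ℕ} (hζ : IsPrimitiveRoot ζ m) {n : ℕ} (hn : n < m) :
    qFactorial ζ n ≠ 0 := by
  refine Finset.prod_ne_zero_iff.2 fun j hj h => ?_
  have hj' : j + 1 < m := by have := Finset.mem_range.1 hj; omega
  have h1 : ζ ^ (j + 1) = 1 := by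
    have := geom_sum_mul ζ (j + 1)
    rw [h, zero_mul] at this
    exact (sub_eq_zero.1 this.symm)
  exact hζ.pow_ne_one_of_pos_of_lt (Nat.succ_ne_zero j) hj' h1

/-- Coefficients of `(X + Y) ^ n` when `Y X = ζ X Y`, via the quantum Pascal rule. -/
def qPascal (ζ : F) : ℕ → ℕ → F
  | _, 0 => 1
  | 0, _ + 1 => 0
  | n + 1, k + 1 => qPascal ζ n k + ζ ^ (k + 1) * qPascal ζ n (k + 1)

theorem qPascal_zero_right (ζ : F) (n : ℕ) : qPascal ζ n 0 = 1 := by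
  cases n <;> rfl

theorem qPascal_of_lt (ζ : F) : ∀ n k : ℕ, n < k → qPascal ζ n k = 0
  | _, 0, h => absurd h (Nat.not_lt_zero _)
  | 0, _ + 1, _ => rfl
  | n + 1, k + 1, h => by
    rw [qPascal, qPascal_of_lt ζ n k (by omega), qPascal_of_lt ζ n (k + 1) (by omega)]
    simp

theorem qPascal_mul (ζ : F) : ∀ n a b : ℕ, a + b = n →
    qPascal ζ n a * (qFactorial ζ a * qFactorial ζ b) = qFactorial ζ n
  | n, 0, b, h => by
    obtain rfl : b = n := by omega
    simp [qPascal_zero_right, qFactorial]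
  | 0, a + 1, b, h => by omega
  | n + 1, a + 1, 0, h => by
    obtain rfl : a = n := by omega
    have h1 := qPascal_mul ζ a a 0 rfl
    rw [qPascal, qPascal_of_lt ζ a (a + 1) (by omega), qFactorial_succ]
    linear_combination (∑ i ∈ Finset.range (a + 1), ζ ^ i) * h1
  | n + 1, a + 1, b + 1, h => by
    have h1 := qPascal_mul ζ n a (b + 1) (by omega)
    have h2 := qPascal_mul ζ n (a + 1) b (by omega)
    have h3 : ∑ i ∈ Finset.range (n + 1), ζ ^ i = (∑ i ∈ Finset.range (a + 1), ζ ^ i)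
        + ζ ^ (a + 1) * ∑ i ∈ Finset.range (b + 1), ζ ^ i := by
      obtain rfl : n = a + 1 + b := by omega
      rw [add_assoc (a + 1), Finset.sum_range_add, Finset.mul_sum]
      simp [pow_add]
    rw [qPascal, qFactorial_succ ζ n, h3]
    rw [qFactorial_succ ζ a] at h2 ⊢
    rw [qFactorial_succ ζ b] at h1 ⊢
    linear_combination (∑ i ∈ Finset.range (a + 1), ζ ^ i) * h1 +
      (ζ ^ (a + 1) * ∑ i ∈ Finset.range (b + 1), ζ ^ i) * h2

theorem qCommute_pow {A : Type*} [Ring A] [Algebra F A] (ζ : F) {X Y : A}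
    (h : Y * X = ζ • (X * Y)) (k : ℕ) : Y * X ^ k = ζ ^ k • (X ^ k * Y) := by
  induction k with
  | zero => simp
  | succ k ih =>
    rw [pow_succ, ← mul_assoc, ih, smul_mul_assoc, mul_assoc, h, mul_smul_comm, smul_smul,
      ← pow_succ, ← mul_assoc]

theorem qCommute_add_pow {A : Type*} [Ring A] [Algebra F A] (ζ : F) {X Y : A}
    (h : Y * X = ζ • (X * Y)) (n : ℕ) :
    (X + Y) ^ n = ∑ k ∈ Finset.range (n + 1), qPascal ζ n k • (X ^ k * Y ^ (n - k)) := by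
  induction n with
  | zero => simp [qPascal_zero_right]
  | succ n ih =>
    rw [pow_succ', ih, add_mul, Finset.mul_sum, Finset.mul_sum,
      Finset.sum_range_succ' _ (n + 1)]
    have e1 : ∀ k ∈ Finset.range (n + 1),
        qPascal ζ (n + 1) (k + 1) • (X ^ (k + 1) * Y ^ (n + 1 - (k + 1))) =
        X * (qPascal ζ n k • (X ^ k * Y ^ (n - k))) +
        (ζ ^ (k + 1) * qPascal ζ n (k + 1)) • (X ^ (k + 1) * Y ^ (n - k)) := by
      intro k _
      rw [qPascal, add_smul, mul_smul_comm, ← mul_assoc, ← pow_succ', Nat.add_sub_add_right]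
    have e2 : ∀ k ∈ Finset.range (n + 1), Y * (qPascal ζ n k • (X ^ k * Y ^ (n - k))) =
        (ζ ^ k * qPascal ζ n k) • (X ^ k * Y ^ (n + 1 - k)) := by
      intro k hk
      have hk' := Finset.mem_range.1 hk
      rw [mul_smul_comm, ← mul_assoc, qCommute_pow ζ h, smul_mul_assoc, smul_smul, mul_assoc,
        ← pow_succ', mul_comm, show n - k + 1 = n + 1 - k by omega]
    rw [Finset.sum_congr rfl e1, Finset.sum_congr rfl e2, Finset.sum_add_distrib, add_assoc]
    congr 1
    rw [Finset.sum_range_succ', Finset.sum_range_succ (fun k =>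
      (ζ ^ (k + 1) * qPascal ζ n (k + 1)) • (X ^ (k + 1) * Y ^ (n - k))),
      qPascal_of_lt ζ n (n + 1) (by omega)]
    simp [qPascal_zero_right]

theorem qCommute_add_pow_eq_zero {A : Type*} [Ring A] [Algebra F A] {ζ : F} {m : ℕ}
    (hζ : IsPrimitiveRoot ζ m) {X Y : A} (h : Y * X = ζ • (X * Y)) (hX : X ^ m = 0)
    (hY : Y ^ m = 0) : (X + Y) ^ m = 0 := by
  rw [qCommute_add_pow ζ h]
  refine Finset.sum_eq_zero fun k hk => ?_
  have hk' : k ≤ m := by have := Finset.mem_range.1 hk; omega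
  rcases Nat.eq_zero_or_pos k with rfl | h0
  · simp [hY]
  rcases hk'.eq_or_lt with rfl | h1
  · simp [hX]
  have hm := qPascal_mul ζ m k (m - k) (by omega)
  have hz : qFactorial ζ m = 0 := by
    obtain ⟨n, rfl⟩ : ∃ n, m = n + 1 := ⟨m - 1, by omega⟩
    rw [qFactorial_succ, hζ.geom_sum_eq_zero (by omega), mul_zero]
  rw [hz] at hm
  have hne := mul_ne_zero (qFactorial_ne_zero hζ h1)
    (qFactorial_ne_zero hζ (show m - k < m by omega))
  rw [(mul_eq_zero.1 hm).resolve_right hne, zero_smul]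

end Quantum

/-! ### The Taft algebra -/

/-- The two generators of a Taft algebra. -/
inductive TaftGen : Type
  | c : TaftGen
  | v : TaftGen

/-- The relations `c ^ m = 1`, `v ^ m = 0`, `v c = ζ c v`. -/
inductive TaftRel {F : Type*} [Field F] (m : ℕ) (ζ : F) :
    FreeAlgebra F TaftGen → FreeAlgebra F TaftGen → Prop
  | c_pow : TaftRel m ζ (FreeAlgebra.ι F TaftGen.c ^ m) 1
  | v_pow : TaftRel m ζ (FreeAlgebra.ι F TaftGen.v ^ m) 0
  | v_mul_c : TaftRel m ζ (FreeAlgebra.ι F TaftGen.v * FreeAlgebra.ι F TaftGen.c)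
      (ζ • (FreeAlgebra.ι F TaftGen.c * FreeAlgebra.ι F TaftGen.v))

/-- The Taft algebra `H_{m²}(ζ)`: the unital algebra generated by `c` and `v` subject to
`c ^ m = 1`, `v ^ m = 0`, `v c = ζ c v`. -/
def TaftAlgebra {F : Type*} [Field F] (m : ℕ) (ζ : F) : Type _ := RingQuot (TaftRel m ζ)

namespace TaftAlgebra

variable {F : Type*} [Field F] (m : ℕ) (ζ : F)

instance instRing : Ring (TaftAlgebra m ζ) := inferInstanceAs (Ring (RingQuot (TaftRel m ζ)))

instance instAlgebra : Algebra F (TaftAlgebra m ζ) :=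
  inferInstanceAs (Algebra F (RingQuot (TaftRel m ζ)))

/-- The quotient map from the free algebra. -/
def mk : FreeAlgebra F TaftGen →ₐ[F] TaftAlgebra m ζ := RingQuot.mkAlgHom F (TaftRel m ζ)

/-- The generator `c`. -/
def c : TaftAlgebra m ζ := mk m ζ (FreeAlgebra.ι F TaftGen.c)

/-- The generator `v`. -/
def v : TaftAlgebra m ζ := mk m ζ (FreeAlgebra.ι F TaftGen.v)

theorem c_pow : c m ζ ^ m = 1 := by
  have := RingQuot.mkAlgHom_rel F (TaftRel.c_pow (m := m) (ζ := ζ))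
  rw [map_pow, map_one] at this
  exact this

theorem v_pow : v m ζ ^ m = 0 := by
  have := RingQuot.mkAlgHom_rel F (TaftRel.v_pow (m := m) (ζ := ζ))
  rw [map_pow, map_zero] at this
  exact this

theorem v_mul_c : v m ζ * c m ζ = ζ • (c m ζ * v m ζ) := by
  have := RingQuot.mkAlgHom_rel F (TaftRel.v_mul_c (m := m) (ζ := ζ))
  rw [map_mul, map_smul, map_mul] at this
  exact this

variable {m ζ} {A : Type*} [Ring A] [Algebra F A]

/-- The universal property of the Taft algebra. -/
def lift (x y : A) (hx : x ^ m = 1) (hy : y ^ m = 0) (hyx : y * x = ζ • (x * y)) :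
    TaftAlgebra m ζ →ₐ[F] A :=
  RingQuot.liftAlgHom F ⟨FreeAlgebra.lift F (fun g => TaftGen.rec x y g), by
    rintro _ _ (_ | _ | _)
    · simpa using hx
    · simpa using hy
    · simpa using hyx⟩

@[simp]
theorem lift_c (x y : A) (hx : x ^ m = 1) (hy : y ^ m = 0) (hyx : y * x = ζ • (x * y)) :
    lift x y hx hy hyx (c m ζ) = x := by
  refine (RingQuot.liftAlgHom_mkAlgHom_apply F _ _ _).trans ?_
  simp

@[simp]
theorem lift_v (x y : A) (hx : x ^ m = 1) (hy : y ^ m = 0) (hyx : y * x = ζ • (x * y)) :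
    lift x y hx hy hyx (v m ζ) = y := by
  refine (RingQuot.liftAlgHom_mkAlgHom_apply F _ _ _).trans ?_
  simp

theorem algHom_ext {f g : TaftAlgebra m ζ →ₐ[F] A} (hc : f (c m ζ) = g (c m ζ))
    (hv : f (v m ζ) = g (v m ζ)) : f = g := by
  refine RingQuot.ringQuot_ext' F f g (FreeAlgebra.hom_ext (funext fun x => ?_))
  cases x
  · exact hc
  · exact hv

variable (m ζ)

/-- The comultiplication: `Δ c = c ⊗ c` and `Δ v = c ⊗ v + v ⊗ 1`. -/
def comulHom [hζ : Fact (IsPrimitiveRoot ζ m)] :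
    TaftAlgebra m ζ →ₐ[F] TaftAlgebra m ζ ⊗[F] TaftAlgebra m ζ :=
  lift (c m ζ ⊗ₜ[F] c m ζ) (c m ζ ⊗ₜ[F] v m ζ + v m ζ ⊗ₜ[F] 1)
    (by rw [Algebra.TensorProduct.tmul_pow, c_pow]; rfl)
    (by
      refine qCommute_add_pow_eq_zero hζ.out ?_ ?_ ?_
      · simp only [Algebra.TensorProduct.tmul_mul_tmul, v_mul_c, one_mul, mul_one,
          TensorProduct.smul_tmul']
      · rw [Algebra.TensorProduct.tmul_pow, v_pow, TensorProduct.tmul_zero]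
      · rw [Algebra.TensorProduct.tmul_pow, v_pow, TensorProduct.zero_tmul])
    (by
      simp only [add_mul, mul_add, smul_add, Algebra.TensorProduct.tmul_mul_tmul, v_mul_c,
        one_mul, mul_one, TensorProduct.smul_tmul', TensorProduct.tmul_smul])

/-- The counit: `ε c = 1` and `ε v = 0`. -/
def counitHom [NeZero m] : TaftAlgebra m ζ →ₐ[F] F :=
  lift 1 0 (one_pow m) (zero_pow (NeZero.ne m)) (by simp)

/-- The bialgebra structure on the Taft algebra. -/
instance instBialgebra [NeZero m] [Fact (IsPrimitiveRoot ζ m)] : Bialgebra F (TaftAlgebra m ζ) :=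
  Bialgebra.ofAlgHom (comulHom m ζ) (counitHom m ζ)
    (by
      refine algHom_ext ?_ ?_
      · simp [comulHom]
      · simp [comulHom, TensorProduct.tmul_add, TensorProduct.add_tmul, add_assoc,
          Algebra.TensorProduct.one_def])
    (by
      refine algHom_ext ?_ ?_
      · simp [comulHom, counitHom]
      · simp [comulHom, counitHom])
    (by
      refine algHom_ext ?_ ?_
      · simp [comulHom, counitHom]
      · simp [comulHom, counitHom])

@[simp]
theorem comul_c [NeZero m] [Fact (IsPrimitiveRoot ζ m)] :
    Coalgebra.comul (R := F) (c m ζ) = c m ζ ⊗ₜ[F] c m ζ :=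
  lift_c _ _ _ _ _

@[simp]
theorem comul_v [NeZero m] [Fact (IsPrimitiveRoot ζ m)] :
    Coalgebra.comul (R := F) (v m ζ) = c m ζ ⊗ₜ[F] v m ζ + v m ζ ⊗ₜ[F] 1 :=
  lift_v _ _ _ _ _

end TaftAlgebra

/-! ### Module Lie algebras over a bialgebra -/

section ModuleLie

variable (F H L : Type*) [Field F] [Ring H] [Bialgebra F H] [LieRing L] [LieAlgebra F L]
  [Module H L] [IsScalarTower F H L]

variable {F H L} in
/-- For `a b : L`, the linear map `h₁ ⊗ h₂ ↦ [h₁ a, h₂ b]`. -/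
def tensorBracket (a b : L) : H ⊗[F] H →ₗ[F] L :=
  TensorProduct.lift (LinearMap.mk₂ F (fun h₁ h₂ : H => ⁅h₁ • a, h₂ • b⁆)
    (fun x y z => by rw [add_smul, add_lie])
    (fun r x z => by rw [smul_assoc, smul_lie])
    (fun x y z => by rw [add_smul, lie_add])
    (fun r x z => by rw [smul_assoc, lie_smul]))

/-- `L` is an `H`-module Lie algebra: `h [a, b] = [h₍₁₎ a, h₍₂₎ b]` for all `h`, `a`, `b`. -/
class IsModuleLieAlgebra : Prop where
  smul_lie_eq : ∀ (h : H) (a b : L),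
    h • ⁅a, b⁆ = tensorBracket a b (Coalgebra.comul (R := F) h)

/-- `L` is `H`-simple: `[L, L] ≠ 0` and the only `H`-invariant ideals are `0` and `L`. -/
structure IsHSimple : Prop where
  non_abelian : ¬ IsLieAbelian L
  eq_bot_or_eq_top : ∀ I : LieIdeal F L, (∀ (h : H), ∀ x ∈ I, h • x ∈ I) → I = ⊥ ∨ I = ⊤

end ModuleLie

/-- The nilpotent radical of a Lie algebra: the sum of all ideals that are nilpotent as Lie
algebras. (In contrast, `LieAlgebra.maxNilpotentIdeal` asks for nilpotency of the action of the
whole algebra on the ideal.) -/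
def lieNilradical (F L : Type*) [CommRing F] [LieRing L] [LieAlgebra F L] : LieIdeal F L :=
  sSup {I : LieIdeal F L | LieRing.IsNilpotent I}

/-- The component `L⁽⁰⁾ = {a | c a = a}` of the grading defined by the action of `c`. -/
def TaftAlgebra.degreeZero {F : Type*} [Field F] (m : ℕ) [NeZero m] (ζ : F)
    [Fact (IsPrimitiveRoot ζ m)] (L : Type*) [LieRing L] [LieAlgebra F L]
    [Module (TaftAlgebra m ζ) L] [IsScalarTower F (TaftAlgebra m ζ) L]
    [IsModuleLieAlgebra F (TaftAlgebra m ζ) L] : LieSubalgebra F L where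
  carrier := {a | TaftAlgebra.c m ζ • a = a}
  add_mem' {a b} ha hb := by
    rw [Set.mem_ofPred_eq] at *
    rw [smul_add, ha, hb]
  zero_mem' := smul_zero _
  smul_mem' r a ha := by
    rw [Set.mem_ofPred_eq] at *
    rw [← algebraMap_smul (TaftAlgebra m ζ) r a, smul_smul, ← Algebra.commutes, ← smul_smul, ha]
  lie_mem' {a b} ha hb := by
    change TaftAlgebra.c m ζ • a = a at ha
    change TaftAlgebra.c m ζ • b = b at hb
    change TaftAlgebra.c m ζ • ⁅a, b⁆ = ⁅a, b⁆
    rw [IsModuleLieAlgebra.smul_lie_eq (F := F), TaftAlgebra.comul_c]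
    simp [tensorBracket, ha, hb]

/-! ### The algebras `L(B, γ)` -/

/-- The space `L(B, γ) = ⨁_{0 ≤ i < m} L⁽ⁱ⁾`, where every `L⁽ⁱ⁾` is a copy of `B`. An element is
given by its components, a function `Fin m → B`; for `a : B`, the function supported at `i` with
value `a` is the element `φⁱ(a)` of `L⁽ⁱ⁾`. -/
@[ext]
structure TaftLie {F : Type*} [Field F] (m : ℕ) (ζ : F) (B : Type*) (γ : F) where
  /-- The components of an element. -/
  coord : Fin m → B

namespace TaftLie

section Space

variable {F : Type*} [Field F] (m : ℕ) (ζ : F) (B : Type*) (γ : F)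

instance instCoeFun : CoeFun (TaftLie m ζ B γ) (fun _ => Fin m → B) := ⟨coord⟩

/-- An element is the same as its family of components. -/
def coordEquiv : TaftLie m ζ B γ ≃ (Fin m → B) where
  toFun f := f.coord
  invFun f := ⟨f⟩

instance instAddCommGroup [AddCommGroup B] : AddCommGroup (TaftLie m ζ B γ) :=
  (coordEquiv m ζ B γ).addCommGroup

instance instModule [AddCommGroup B] [Module F B] : Module F (TaftLie m ζ B γ) :=
  (coordEquiv m ζ B γ).module F

variable {B} in
/-- The element `φᵏ(a)`. -/
def phi [AddCommGroup B] (k : Fin m) (a : B) : TaftLie m ζ B γ := ⟨Pi.single k a⟩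

variable {m ζ B γ}

theorem ext_apply {f g : TaftLie m ζ B γ} (h : ∀ i, f i = g i) : f = g := TaftLie.ext (funext h)

@[simp] theorem add_apply [AddCommGroup B] (f g : TaftLie m ζ B γ) (i : Fin m) :
    (f + g) i = f i + g i := rfl
@[simp] theorem neg_apply [AddCommGroup B] (f : TaftLie m ζ B γ) (i : Fin m) :
    (-f) i = -f i := rfl
@[simp] theorem zero_apply [AddCommGroup B] (i : Fin m) : (0 : TaftLie m ζ B γ) i = 0 := rfl
@[simp] theorem smul_apply [AddCommGroup B] [Module F B] (r : F) (f : TaftLie m ζ B γ)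
    (i : Fin m) : (r • f) i = r • f i := rfl

end Space

variable {F : Type*} [Field F] (m : ℕ) (ζ : F) (B : Type*) [LieRing B] [LieAlgebra F B] (γ : F)

/-- The action of `c`: multiplication by `ζⁱ` on `L⁽ⁱ⁾`. -/
def cAct : Module.End F (TaftLie m ζ B γ) where
  toFun f := ⟨fun i => ζ ^ (i : ℕ) • f i⟩
  map_add' f g := by ext i; simp
  map_smul' r f := by ext i; simp [smul_comm r]

/-- The action of `v`: `v φᵏ⁺¹(a) = φᵏ(a)` and `v φ⁰(a) = 0`. -/
def vAct : Module.End F (TaftLie m ζ B γ) where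
  toFun f := ⟨fun i => if h : (i : ℕ) + 1 < m then f ⟨i + 1, h⟩ else 0⟩
  map_add' f g := by ext i; simp only [add_apply]; split <;> simp
  map_smul' r f := by ext i; simp only [smul_apply]; split <;> simp

@[simp] theorem cAct_apply (f : TaftLie m ζ B γ) (i : Fin m) :
    cAct m ζ B γ f i = ζ ^ (i : ℕ) • f i := rfl

theorem vAct_apply (f : TaftLie m ζ B γ) (i : Fin m) :
    vAct m ζ B γ f i = if h : (i : ℕ) + 1 < m then f ⟨i + 1, h⟩ else 0 := rfl

theorem cAct_pow_apply (n : ℕ) (f : TaftLie m ζ B γ) (i : Fin m) :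
    (cAct m ζ B γ ^ n) f i = (ζ ^ (i : ℕ)) ^ n • f i := by
  induction n generalizing f with
  | zero => simp
  | succ n ih => rw [pow_succ, Module.End.mul_apply, ih, cAct_apply, smul_smul, pow_succ]

theorem vAct_pow_apply (n : ℕ) (f : TaftLie m ζ B γ) (i : Fin m) :
    (vAct m ζ B γ ^ n) f i = if h : (i : ℕ) + n < m then f ⟨i + n, h⟩ else 0 := by
  induction n generalizing f with
  | zero => simp
  | succ n ih =>
    rw [pow_succ, Module.End.mul_apply, ih]
    simp only [vAct_apply, add_assoc]
    split_ifs with h1 h2 <;> first | rfl | omega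

/-- The action of the Taft algebra on `L(B, γ)`. -/
def action [hζ : Fact (IsPrimitiveRoot ζ m)] :
    TaftAlgebra m ζ →ₐ[F] Module.End F (TaftLie m ζ B γ) :=
  TaftAlgebra.lift (cAct m ζ B γ) (vAct m ζ B γ)
    (by
      ext f i
      rw [cAct_pow_apply, ← pow_mul, mul_comm, pow_mul, hζ.out.pow_eq_one]
      simp)
    (by
      ext f i
      rw [vAct_pow_apply]
      simp)
    (by
      ext f i
      simp only [Module.End.mul_apply, vAct_apply, cAct_apply, LinearMap.smul_apply, smul_apply]
      split_ifs
      · rw [smul_smul, pow_succ']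
      · simp)

instance instModuleTaft [Fact (IsPrimitiveRoot ζ m)] :
    Module (TaftAlgebra m ζ) (TaftLie m ζ B γ) :=
  Module.compHom _ (action m ζ B γ).toRingHom

instance instIsScalarTower [Fact (IsPrimitiveRoot ζ m)] :
    IsScalarTower F (TaftAlgebra m ζ) (TaftLie m ζ B γ) where
  smul_assoc r h f := by
    change action m ζ B γ (r • h) f = r • action m ζ B γ h f
    rw [map_smul, LinearMap.smul_apply]

theorem c_smul_apply [Fact (IsPrimitiveRoot ζ m)] (f : TaftLie m ζ B γ) (i : Fin m) :
    (TaftAlgebra.c m ζ • f) i = ζ ^ (i : ℕ) • f i := by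
  change action m ζ B γ _ f i = _
  simp [action]

theorem v_smul_apply [Fact (IsPrimitiveRoot ζ m)] (f : TaftLie m ζ B γ) (i : Fin m) :
    (TaftAlgebra.v m ζ • f) i = if h : (i : ℕ) + 1 < m then f ⟨i + 1, h⟩ else 0 := by
  change action m ζ B γ _ f i = _
  simp [action, vAct_apply]

variable {m} in
/-- The scalar `s` with `[φᵏ(a), φˡ(b)]⁽ⁱ⁾ = s φⁱ[a, b]`. -/
def coeff (k l i : Fin m) : F :=
  if (k : ℕ) + l = i then qBinom ζ (k + l) k
  else if (k : ℕ) + l = i + m then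
    γ * (qFactorial ζ (k + l - m) / (qFactorial ζ k * qFactorial ζ l))
  else 0

variable {m} in
theorem coeff_eq (k l i : Fin m) : coeff ζ γ k l i =
    (if (k : ℕ) + l = i then 1 else if (k : ℕ) + l = i + m then γ else 0) *
      (qFactorial ζ i / (qFactorial ζ k * qFactorial ζ l)) := by
  unfold coeff qBinom
  split_ifs with h1 h2
  · rw [h1, show (i : ℕ) - k = l by omega, one_mul, mul_comm (qFactorial ζ l)]
  · rw [h2, Nat.add_sub_cancel]
  · rw [zero_mul]

variable {m} in
theorem coeff_comm (k l i : Fin m) : coeff ζ γ k l i = coeff ζ γ l k i := by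
  rw [coeff_eq, coeff_eq, add_comm (k : ℕ), mul_comm (qFactorial ζ k)]

variable {m} in
/-- The structure constants of iterated brackets. -/
def coeffThree (k l n i : Fin m) : F :=
  (if (k : ℕ) + l + n = i then 1 else if (k : ℕ) + l + n = i + m then γ
      else if (k : ℕ) + l + n = i + m + m then γ * γ else 0) *
    (qFactorial ζ i / (qFactorial ζ k * qFactorial ζ l * qFactorial ζ n))

variable {m} in
theorem coeffThree_swap (k l n i : Fin m) : coeffThree ζ γ l k n i = coeffThree ζ γ k l n i := by
  unfold coeffThree
  rw [add_comm (l : ℕ), mul_comm (qFactorial ζ l)]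

variable {m} in
theorem coeffThree_rotate (k l n i : Fin m) :
    coeffThree ζ γ n k l i = coeffThree ζ γ k l n i := by
  unfold coeffThree
  rw [show (n : ℕ) + k + l = k + l + n by omega, show qFactorial ζ n * qFactorial ζ k *
    qFactorial ζ l = qFactorial ζ k * qFactorial ζ l * qFactorial ζ n by ring]

variable {m} in
theorem sum_coeff (hζ : IsPrimitiveRoot ζ m) (k l n i : Fin m) :
    ∑ p, coeff ζ γ k p i * coeff ζ γ l n p =
      coeffThree ζ γ k l n i := by
  unfold coeffThree
  have key : ∀ p : Fin m, (∀ q : Fin m, q ≠ p → coeff ζ γ l n q = 0) →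
      ∑ p, coeff ζ γ k p i * coeff ζ γ l n p = coeff ζ γ k p i * coeff ζ γ l n p := by
    intro p hp
    refine Finset.sum_eq_single p (fun q _ hq => ?_) (fun h => absurd (Finset.mem_univ _) h)
    rw [hp q hq, mul_zero]
  have hk := k.2
  have hl := l.2
  have hn := n.2
  have hi := i.2
  have fk := qFactorial_ne_zero hζ hk
  have fl := qFactorial_ne_zero hζ hl
  have fn := qFactorial_ne_zero hζ hn
  by_cases h : (l : ℕ) + n < m
  · rw [key ⟨l + n, h⟩]
    · have fp := qFactorial_ne_zero hζ h
      rw [coeff_eq, coeff_eq]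
      simp only [if_true]
      rw [show (k : ℕ) + (l + n) = k + l + n by omega]
      split_ifs <;> first | omega | (simp only [zero_mul]) | (field_simp)
    · intro q hq
      have hq' : (q : ℕ) ≠ l + n := fun e => hq (Fin.ext e)
      have hq2 := q.2
      rw [coeff_eq, if_neg (by omega), if_neg (by omega), zero_mul]
  · have h' : (l : ℕ) + n - m < m := by omega
    rw [key ⟨l + n - m, h'⟩]
    · have fp := qFactorial_ne_zero hζ h'
      rw [coeff_eq, coeff_eq]
      simp only
      rw [if_neg (show ¬ (l : ℕ) + n = l + n - m by omega),
        if_pos (show (l : ℕ) + n = l + n - m + m by omega)]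
      split_ifs <;> first | omega | (simp only [zero_mul]) | (field_simp)
    · intro q hq
      have hq' : (q : ℕ) ≠ l + n - m := fun e => hq (Fin.ext e)
      have hq2 := q.2
      rw [coeff_eq, if_neg (by omega), if_neg (by omega), zero_mul]

instance instBracket : Bracket (TaftLie m ζ B γ) (TaftLie m ζ B γ) where
  bracket f g := ⟨fun i => ∑ k, ∑ l, coeff ζ γ k l i • ⁅f k, g l⁆⟩

variable {m ζ B γ}

theorem lie_apply (f g : TaftLie m ζ B γ) (i : Fin m) :
    ⁅f, g⁆ i = ∑ k, ∑ l, coeff ζ γ k l i • ⁅f k, g l⁆ := rfl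

variable (m ζ B γ)

theorem lie_lie_apply (hζ : IsPrimitiveRoot ζ m) (f g h : TaftLie m ζ B γ) (i : Fin m) :
    ⁅f, ⁅g, h⁆⁆ i = ∑ k : Fin m, ∑ l : Fin m, ∑ n : Fin m,
      coeffThree ζ γ k l n i • ⁅f k, ⁅g l, h n⁆⁆ := by
  rw [lie_apply]
  refine Finset.sum_congr rfl fun k _ => ?_
  simp only [lie_apply, lie_sum, lie_smul, Finset.smul_sum, smul_smul]
  rw [Finset.sum_comm]
  refine Finset.sum_congr rfl fun l _ => ?_
  rw [Finset.sum_comm]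
  refine Finset.sum_congr rfl fun n _ => ?_
  rw [← Finset.sum_smul, sum_coeff ζ γ hζ]

theorem lie_skew_aux (f g : TaftLie m ζ B γ) : ⁅f, g⁆ = -⁅g, f⁆ := by
  ext i
  change ⁅f, g⁆ i = -(⁅g, f⁆ i)
  rw [lie_apply, lie_apply, Finset.sum_comm, ← Finset.sum_neg_distrib]
  refine Finset.sum_congr rfl fun k _ => ?_
  rw [← Finset.sum_neg_distrib]
  refine Finset.sum_congr rfl fun l _ => ?_
  rw [coeff_comm, ← lie_skew, smul_neg]

theorem jacobi_aux (hζ : IsPrimitiveRoot ζ m) (f g h : TaftLie m ζ B γ) :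
    ⁅f, ⁅g, h⁆⁆ = ⁅⁅f, g⁆, h⁆ + ⁅g, ⁅f, h⁆⁆ := by
  rw [lie_skew_aux m ζ B γ ⁅f, g⁆ h]
  ext i
  change ⁅f, ⁅g, h⁆⁆ i = -(⁅h, ⁅f, g⁆⁆ i) + ⁅g, ⁅f, h⁆⁆ i
  rw [lie_lie_apply m ζ B γ hζ f g h, lie_lie_apply m ζ B γ hζ h f g,
    lie_lie_apply m ζ B γ hζ g f h]
  have e1 : ∑ k : Fin m, ∑ l : Fin m, ∑ n : Fin m, coeffThree ζ γ k l n i • ⁅h k, ⁅f l, g n⁆⁆ =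
      ∑ k : Fin m, ∑ l : Fin m, ∑ n : Fin m, coeffThree ζ γ k l n i • ⁅h n, ⁅f k, g l⁆⁆ := by
    rw [Finset.sum_comm]
    refine Finset.sum_congr rfl fun k _ => ?_
    rw [Finset.sum_comm]
    refine Finset.sum_congr rfl fun l _ => Finset.sum_congr rfl fun n _ => ?_
    rw [coeffThree_rotate]
  have e2 : ∑ k : Fin m, ∑ l : Fin m, ∑ n : Fin m, coeffThree ζ γ k l n i • ⁅g k, ⁅f l, h n⁆⁆ =
      ∑ k : Fin m, ∑ l : Fin m, ∑ n : Fin m, coeffThree ζ γ k l n i • ⁅g l, ⁅f k, h n⁆⁆ := by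
    rw [Finset.sum_comm]
    refine Finset.sum_congr rfl fun k _ => Finset.sum_congr rfl fun l _ =>
      Finset.sum_congr rfl fun n _ => ?_
    rw [coeffThree_swap]
  rw [e1, e2]
  simp only [← Finset.sum_neg_distrib, ← Finset.sum_add_distrib, ← smul_neg, ← smul_add]
  refine Finset.sum_congr rfl fun k _ => Finset.sum_congr rfl fun l _ =>
    Finset.sum_congr rfl fun n _ => ?_
  rw [lie_skew, ← leibniz_lie]

instance instLieRing [hζ : Fact (IsPrimitiveRoot ζ m)] : LieRing (TaftLie m ζ B γ) where
  add_lie f g h := by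
    ext i
    simp only [lie_apply, add_apply, add_lie, smul_add, Finset.sum_add_distrib]
  lie_add f g h := by
    ext i
    simp only [lie_apply, add_apply, lie_add, smul_add, Finset.sum_add_distrib]
  lie_self f := by
    ext i
    rw [lie_apply, zero_apply, ← Finset.sum_product']
    refine Finset.sum_involution (fun p _ => p.swap) (fun p _ => ?_) (fun p _ hp he => hp ?_)
      (fun p _ => Finset.mem_product.2 ⟨Finset.mem_univ _, Finset.mem_univ _⟩)
      (fun p _ => Prod.swap_swap p)
    · rw [Prod.fst_swap, Prod.snd_swap, coeff_comm, ← smul_add, ← lie_skew, neg_add_cancel,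
        smul_zero]
    · have : p.2 = p.1 := congrArg Prod.fst he
      rw [this, lie_self, smul_zero]
  leibniz_lie f g h := jacobi_aux m ζ B γ hζ.out f g h

instance instLieAlgebra [Fact (IsPrimitiveRoot ζ m)] : LieAlgebra F (TaftLie m ζ B γ) where
  lie_smul r f g := by
    ext i
    simp only [lie_apply, smul_apply, lie_smul, Finset.smul_sum]
    exact Finset.sum_congr rfl fun k _ => Finset.sum_congr rfl fun l _ => smul_comm _ _ _

variable {B} in
theorem phi_lie_phi_apply (k l : Fin m) (a b : B) (i : Fin m) :
    ⁅phi m ζ γ k a, phi m ζ γ l b⁆ i = coeff ζ γ k l i • ⁅a, b⁆ := by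
  rw [lie_apply, Finset.sum_eq_single k, Finset.sum_eq_single l]
  · simp [phi]
  · intro q _ hq
    simp [phi, Pi.single_eq_of_ne hq]
  · intro h
    exact absurd (Finset.mem_univ _) h
  · intro q _ hq
    simp [phi, Pi.single_eq_of_ne hq]
  · intro h
    exact absurd (Finset.mem_univ _) h

variable {B} in
/-- `[φᵏ(a), φˡ(b)] = binom(k+l, k)_ζ φᵏ⁺ˡ[a, b]` for `k + l < m`. -/
theorem phi_lie_phi_of_lt (k l : Fin m) (a b : B) (h : (k : ℕ) + l < m) :
    ⁅phi m ζ γ k a, phi m ζ γ l b⁆ = qBinom ζ (k + l) k • phi m ζ γ ⟨k + l, h⟩ ⁅a, b⁆ := by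
  ext i
  rw [phi_lie_phi_apply, smul_apply, coeff]
  have hi := i.2
  by_cases hi' : (k : ℕ) + l = i
  · obtain rfl : i = ⟨k + l, h⟩ := Fin.ext hi'.symm
    simp [phi]
  · rw [if_neg hi', if_neg (by omega), zero_smul]
    simp only [phi]
    rw [Pi.single_eq_of_ne (fun e => hi' (by rw [e])), smul_zero]

variable {B} in
/-- `[φᵏ(a), φˡ(b)] = γ (k+l-m)!_ζ / (k!_ζ l!_ζ) φᵏ⁺ˡ⁻ᵐ[a, b]` for `k + l ≥ m`. -/
theorem phi_lie_phi_of_ge (k l : Fin m) (a b : B) (h : m ≤ (k : ℕ) + l) :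
    ⁅phi m ζ γ k a, phi m ζ γ l b⁆ =
      (γ * (qFactorial ζ (k + l - m) / (qFactorial ζ k * qFactorial ζ l))) •
        phi m ζ γ ⟨k + l - m, by omega⟩ ⁅a, b⁆ := by
  ext i
  rw [phi_lie_phi_apply, smul_apply, coeff]
  have hi := i.2
  rw [if_neg (by omega)]
  by_cases hi' : (k : ℕ) + l = i + m
  · have he : (⟨k + l - m, by omega⟩ : Fin m) = i := Fin.ext (by simp only; omega)
    rw [if_pos hi', he]
    simp [phi]
  · rw [if_neg hi', zero_smul]
    simp only [phi]
    rw [Pi.single_eq_of_ne (fun e => hi' (by rw [e]; simp only; omega)), smul_zero]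

end TaftLie

end

/-!
Among the nonzero `c`-invariant ideals inside the solvable radical choose a minimal one, `A`.
The ideal `{b ∈ A | v b ∈ A}` is `c`-invariant, so by minimality it is `0` or `A`, and it is not
`A` because `A` would then be an `H`-invariant proper ideal. Expanding `v [x, b] = -v [b, x]`
gives `[c x - x, v b] = [v x, c b - b] ∈ A`; hence `[c x - x, b]` lies in the above ideal, that is,
`(c - 1) L` centralizes `A`. The centralizer of `A` is proper since `L` has no center, and the
projection `π` onto the quotient `B` by a maximal ideal containing it is a morphism onto a simple
Lie algebra with `π (c x) = π x`.

For such a `π` the quantum Leibniz rule makes `x ↦ (π (vⁱ x))ᵢ` an `H`-equivariant morphism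
`L → L(B, 0)`, whose kernel is an `H`-invariant ideal, hence `0`. It is onto by successive
approximation: for the filtration of `L` by the order of vanishing of `π (vⁿ x)` in `n`, the leading
coefficients of order `k` form an ideal of `B`, which is `B` for `k = 0`; it is nonzero for `k = 1`,
as otherwise `ker π` would be `H`-invariant, and then for all `k < m` because
`[φᵏ(a), φ¹(b)]` is a nonzero multiple of `φᵏ⁺¹([a, b])`. The same filtration shows that
`ker π` is nilpotent.
-/

open Finset.HasAntidiagonal (antidiagonal)

section LieAlgebra

variable {R L L' : Type*} [CommRing R] [LieRing L] [LieAlgebra R L] [LieRing L'] [LieAlgebra R L']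

theorem nontrivial_of_not_isLieAbelian (h : ¬IsLieAbelian L) : Nontrivial L := by
  by_contra hL
  rw [not_nontrivial_iff_subsingleton] at hL
  exact h ⟨fun _ _ => Subsingleton.elim _ _⟩

theorem map_derivedSeriesOfIdeal {f : L →ₗ⁅R⁆ L'} (hf : Function.Surjective f) (I : LieIdeal R L)
    (k : ℕ) :
    (LieAlgebra.derivedSeriesOfIdeal R L k I).map f =
      LieAlgebra.derivedSeriesOfIdeal R L' k (I.map f) := by
  induction k with
  | zero => rfl
  | succ k ih =>
    rw [LieAlgebra.derivedSeriesOfIdeal_succ, LieAlgebra.derivedSeriesOfIdeal_succ,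
      LieIdeal.map_bracket_eq f hf, ih]

theorem map_radical_le_radical [IsNoetherian R L] {f : L →ₗ⁅R⁆ L'} (hf : Function.Surjective f) :
    (LieAlgebra.radical R L).map f ≤ LieAlgebra.radical R L' := by
  obtain ⟨k, hk⟩ := LieAlgebra.IsSolvable.solvable R (LieAlgebra.radical R L)
  refine le_sSup (LieAlgebra.IsSolvable.mk (R := R) (k := k) ?_)
  rw [LieIdeal.derivedSeries_eq_bot_iff] at hk ⊢
  rw [← map_derivedSeriesOfIdeal hf, hk, LieIdeal.map_eq_bot_iff]
  exact bot_le

theorem radical_ne_top_of_derivedSeries_one_eq_top [IsNoetherian R L] [Nontrivial L]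
    (hL : LieAlgebra.derivedSeries R L 1 = ⊤) : LieAlgebra.radical R L ≠ ⊤ := by
  intro h
  obtain ⟨k, hk⟩ := LieAlgebra.IsSolvable.solvable R (LieAlgebra.radical R L)
  rw [h, LieIdeal.derivedSeries_eq_bot_iff] at hk
  exact top_ne_bot ((LieIdeal.derivedSeries_eq_top k hL).symm.trans hk)

theorem lieNilradical_le_radical : lieNilradical R L ≤ LieAlgebra.radical R L :=
  sSup_le_sSup fun I (_ : LieRing.IsNilpotent I) => LieAlgebra.isSolvable_of_isNilpotent I

theorem ker_ne_top_of_surjective [Nontrivial L'] {f : L →ₗ⁅R⁆ L'}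
    (hf : Function.Surjective f) : f.ker ≠ ⊤ := by
  obtain ⟨y, hy⟩ := exists_ne (0 : L')
  obtain ⟨x, rfl⟩ := hf y
  exact fun h => hy (LieHom.mem_ker.1 (h ▸ LieSubmodule.mem_top x))

theorem radical_le_ker [IsNoetherian R L] [LieAlgebra.HasTrivialRadical R L'] {f : L →ₗ⁅R⁆ L'}
    (hf : Function.Surjective f) : LieAlgebra.radical R L ≤ f.ker := by
  rw [← LieIdeal.map_eq_bot_iff, eq_bot_iff]
  exact (map_radical_le_radical hf).trans_eq LieAlgebra.HasTrivialRadical.radical_eq_bot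

theorem radical_eq_lieNilradical_of_isNilpotent_ker [IsNoetherian R L]
    [LieAlgebra.HasTrivialRadical R L'] {f : L →ₗ⁅R⁆ L'} (hf : Function.Surjective f)
    (hker : LieRing.IsNilpotent f.ker) : LieAlgebra.radical R L = lieNilradical R L :=
  le_antisymm ((radical_le_ker hf).trans (le_sSup hker)) lieNilradical_le_radical

theorem isNilpotent_of_lie_le {I : LieIdeal R L} (N : ℕ → LieIdeal R L) {n : ℕ} (h0 : N 0 = ⊤)
    (hN : ∀ k, ⁅I, N k⁆ ≤ N (k + 1)) (hn : N n = ⊥) : LieRing.IsNilpotent I := by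
  have hle : ∀ k, I.lcs L k ≤ N k := by
    intro k
    induction k with
    | zero => exact h0.symm ▸ le_top
    | succ k ih =>
      rw [LieIdeal.lcs_succ]
      exact (LieSubmodule.mono_lie_right I ih).trans (hN k)
  have hL : LieModule.IsNilpotent I L := by
    refine (LieModule.isNilpotent_iff R I L).2 ⟨n, ?_⟩
    rw [← LieSubmodule.toSubmodule_inj, ← LieIdeal.coe_lcs_eq, eq_bot_iff.2 ((hle n).trans_eq hn),
      LieSubmodule.bot_toSubmodule, LieSubmodule.bot_toSubmodule]
  exact Function.Injective.lieModuleIsNilpotent (f := (LieHom.id : I →ₗ⁅R⁆ I))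
    (g := I.toSubmodule.subtype) (fun _ _ => rfl) Subtype.val_injective

/-- The projection `L → L ⧸ K` as a morphism of Lie algebras; Mathlib's
`LieSubmodule.Quotient.mk'` is only a morphism of `L`-modules. -/
def lieQuotientMap (K : LieIdeal R L) : L →ₗ⁅R⁆ L ⧸ K :=
  { (LieSubmodule.Quotient.mk' K : L →ₗ[R] L ⧸ K) with
    map_lie' := LieSubmodule.Quotient.mk_bracket K _ _ }

theorem lieQuotientMap_surjective (K : LieIdeal R L) : Function.Surjective (lieQuotientMap K) :=
  LieSubmodule.Quotient.surjective_mk' K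

theorem lieQuotientMap_eq_zero_iff {K : LieIdeal R L} {x : L} : lieQuotientMap K x = 0 ↔ x ∈ K :=
  LieSubmodule.Quotient.mk_eq_zero K

theorem isSimple_quotient_of_isCoatom (hL : LieAlgebra.derivedSeries R L 1 = ⊤)
    {K : LieIdeal R L} (hK : IsCoatom K) : LieAlgebra.IsSimple R (L ⧸ K) where
  eq_bot_or_eq_top I := by
    have hle : K ≤ I.comap (lieQuotientMap K) := fun x hx =>
      LieIdeal.mem_comap.2 ((lieQuotientMap_eq_zero_iff.2 hx).symm ▸ I.zero_mem)
    have hsurj := lieQuotientMap_surjective K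
    refine (hK.le_iff.1 hle).symm.imp (fun h => ?_) fun h => ?_
    · refine (LieSubmodule.eq_bot_iff I).2 (hsurj.forall.2 fun x hx => ?_)
      exact lieQuotientMap_eq_zero_iff.2 (h ▸ LieIdeal.mem_comap.2 hx)
    · refine eq_top_iff.2 fun y _ => ?_
      obtain ⟨x, rfl⟩ := hsurj y
      exact LieIdeal.mem_comap.1 (h ▸ LieSubmodule.mem_top x)
  non_abelian habelian := by
    refine hK.1 (top_le_iff.1 (hL ▸ (LieSubmodule.lie_le_iff _ _ _).2 fun x _ y _ => ?_))
    rw [← lieQuotientMap_eq_zero_iff, LieHom.map_lie, trivial_lie_zero]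

end LieAlgebra

section Averaging

theorem map_pow_smul_of_map_smul {G X Y : Type*} [Monoid G] [MulAction G X] {f : X → Y} {g : G}
    (hf : ∀ x, f (g • x) = f x) (n : ℕ) (x : X) : f (g ^ n • x) = f x := by
  induction n with
  | zero => rw [pow_zero, one_smul]
  | succ n ih => rw [pow_succ', mul_smul, hf, ih]

theorem exists_smul_eq_self_and_map_eq {K G M N : Type*} [DivisionRing K] [Monoid G]
    [AddCommGroup M] [Module K M] [DistribMulAction G M] [SMulCommClass G K M] [AddCommGroup N]
    [Module K N] {g : G} {n : ℕ} (hg : g ^ n = 1) (hn : (n : K) ≠ 0) (f : M →ₗ[K] N)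
    (hf : ∀ x, f (g • x) = f x) (x : M) : ∃ y, g • y = y ∧ f y = f x := by
  have hsum : g • ∑ j ∈ Finset.range n, g ^ j • x = ∑ j ∈ Finset.range n, g ^ j • x := by
    have h := Finset.sum_range_succ (fun j => g ^ j • x) n
    rw [Finset.sum_range_succ', pow_zero, hg] at h
    simpa only [Finset.smul_sum, ← mul_smul, ← pow_succ'] using add_right_cancel h
  refine ⟨(n : K)⁻¹ • ∑ j ∈ Finset.range n, g ^ j • x, by rw [smul_comm, hsum], ?_⟩
  simp only [map_smul, map_sum, map_pow_smul_of_map_smul hf, Finset.sum_const, Finset.card_range]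
  rw [← Nat.cast_smul_eq_nsmul K, inv_smul_smul₀ hn]

end Averaging

section QBinomial

variable {F : Type*} [Field F] {m : ℕ} {ζ : F}

theorem qPascal_ne_zero (hζ : IsPrimitiveRoot ζ m) {k l : ℕ} (h : k + l < m) :
    qPascal ζ (k + l) l ≠ 0 := by
  intro h0
  have h1 := qPascal_mul ζ (k + l) l k (add_comm l k)
  rw [h0, zero_mul] at h1
  exact qFactorial_ne_zero hζ h h1.symm

theorem qPascal_eq_qBinom (hζ : IsPrimitiveRoot ζ m) {k l : ℕ} (hk : k < m) (hl : l < m) :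
    qPascal ζ (k + l) l = qBinom ζ (k + l) k := by
  rw [qBinom, Nat.add_sub_cancel_left,
    eq_div_iff (mul_ne_zero (qFactorial_ne_zero hζ hl) (qFactorial_ne_zero hζ hk)),
    qPascal_mul ζ (k + l) l k (add_comm l k)]

end QBinomial

namespace TaftAlgebra

section Representation

variable {F : Type*} [Field F] {m : ℕ} {ζ : F}

theorem v_pow_mul_c (n : ℕ) : v m ζ ^ n * c m ζ = ζ ^ n • (c m ζ * v m ζ ^ n) := by
  induction n with
  | zero => simp
  | succ n ih =>
    rw [pow_succ', mul_assoc, ih, mul_smul_comm, ← mul_assoc, v_mul_c, smul_mul_assoc, smul_smul,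
      mul_assoc, ← pow_succ]

variable {M : Type*} [AddCommGroup M] [Module (TaftAlgebra m ζ) M]

theorem v_pow_smul_eq_zero {n : ℕ} (hn : m ≤ n) (x : M) : v m ζ ^ n • x = 0 := by
  rw [pow_eq_zero_of_le hn (v_pow m ζ), zero_smul]

theorem c_smul_surjective [NeZero m] : Function.Surjective fun x : M => c m ζ • x := by
  refine fun x => ⟨c m ζ ^ (m - 1) • x, ?_⟩
  dsimp only
  rw [← mul_smul, mul_pow_sub_one (NeZero.ne m), c_pow, one_smul]

variable [Module F M] [IsScalarTower F (TaftAlgebra m ζ) M] {N : Type*} [AddCommGroup N]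
  [Module F N] [Module (TaftAlgebra m ζ) N] [IsScalarTower F (TaftAlgebra m ζ) N]

theorem smul_mem_of_c_v (W : Submodule F M) (hc : ∀ x ∈ W, c m ζ • x ∈ W)
    (hv : ∀ x ∈ W, v m ζ • x ∈ W) (h : TaftAlgebra m ζ) : ∀ x ∈ W, h • x ∈ W := by
  obtain ⟨p, rfl⟩ := RingQuot.mkAlgHom_surjective F (TaftRel m ζ) h
  change ∀ x ∈ W, mk m ζ p • x ∈ W
  induction p using FreeAlgebra.induction with
  | grade0 r =>
    intro x hx
    rw [AlgHom.commutes, algebraMap_smul]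
    exact W.smul_mem r hx
  | grade1 g =>
    cases g
    · exact hc
    · exact hv
  | mul a b ha hb =>
    intro x hx
    rw [map_mul, mul_smul]
    exact ha _ (hb x hx)
  | add a b ha hb =>
    intro x hx
    rw [map_add, add_smul]
    exact W.add_mem (ha x hx) (hb x hx)

theorem map_smul_of_c_v (f : M →ₗ[F] N) (hc : ∀ x, f (c m ζ • x) = c m ζ • f x)
    (hv : ∀ x, f (v m ζ • x) = v m ζ • f x) (h : TaftAlgebra m ζ) (x : M) :
    f (h • x) = h • f x := by
  have hgraph : h • (x, f x) ∈ f.graph := by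
    refine smul_mem_of_c_v f.graph ?_ ?_ h (x, f x) rfl
    · rintro ⟨y, _⟩ (rfl : _ = f y)
      exact (hc y).symm
    · rintro ⟨y, _⟩ (rfl : _ = f y)
      exact (hv y).symm
  exact hgraph.symm

end Representation

section ModuleLieAlgebra

variable {F : Type*} [Field F] {m : ℕ} [NeZero m] {ζ : F} [Fact (IsPrimitiveRoot ζ m)]

theorem comul_v_pow (n : ℕ) : Coalgebra.comul (R := F) (v m ζ ^ n) =
    ∑ p ∈ antidiagonal n, qPascal ζ n p.2 •
      ((c m ζ ^ p.2 * v m ζ ^ p.1) ⊗ₜ[F] (v m ζ ^ p.2)) := by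
  have hpow : Coalgebra.comul (R := F) (v m ζ ^ n) = Coalgebra.comul (R := F) (v m ζ) ^ n :=
    map_pow (Bialgebra.comulAlgHom F (TaftAlgebra m ζ)) (v m ζ) n
  have hcomm : (v m ζ ⊗ₜ[F] 1) * (c m ζ ⊗ₜ[F] v m ζ) =
      ζ • ((c m ζ ⊗ₜ[F] v m ζ) * (v m ζ ⊗ₜ[F] (1 : TaftAlgebra m ζ))) := by
    simp only [Algebra.TensorProduct.tmul_mul_tmul, v_mul_c, one_mul, mul_one,
      TensorProduct.smul_tmul']
  rw [hpow, comul_v, qCommute_add_pow ζ hcomm, ← Finset.Nat.sum_antidiagonal_swap,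
    Finset.Nat.sum_antidiagonal_eq_sum_range_succ_mk]
  simp only [Prod.fst_swap, Prod.snd_swap, Algebra.TensorProduct.tmul_pow,
    Algebra.TensorProduct.tmul_mul_tmul, one_pow, mul_one]

variable {L : Type*} [LieRing L] [LieAlgebra F L] [Module (TaftAlgebra m ζ) L]
  [IsScalarTower F (TaftAlgebra m ζ) L] [IsModuleLieAlgebra F (TaftAlgebra m ζ) L]

variable (F) in
theorem c_smul_lie (x y : L) : c m ζ • ⁅x, y⁆ = ⁅c m ζ • x, c m ζ • y⁆ := by
  rw [IsModuleLieAlgebra.smul_lie_eq (F := F), comul_c]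
  rfl

variable (F) in
theorem v_smul_lie (x y : L) :
    v m ζ • ⁅x, y⁆ = ⁅c m ζ • x, v m ζ • y⁆ + ⁅v m ζ • x, y⁆ := by
  rw [IsModuleLieAlgebra.smul_lie_eq (F := F), comul_v, map_add]
  exact congrArg (_ + ⁅v m ζ • x, ·⁆) (one_smul (TaftAlgebra m ζ) y)

variable (F) in
theorem c_smul_sub_lie_v_smul (x y : L) :
    ⁅c m ζ • x - x, v m ζ • y⁆ = ⁅v m ζ • x, c m ζ • y - y⁆ := by
  have h : v m ζ • ⁅x, y⁆ = -(v m ζ • ⁅y, x⁆) := by rw [← smul_neg, lie_skew]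
  rw [v_smul_lie F, v_smul_lie F, neg_add, lie_skew, lie_skew] at h
  rw [sub_lie, lie_sub, sub_eq_sub_iff_add_eq_add, h]

variable (F) in
theorem v_pow_smul_lie (n : ℕ) (x y : L) : v m ζ ^ n • ⁅x, y⁆ =
    ∑ p ∈ antidiagonal n, qPascal ζ n p.2 •
      ⁅c m ζ ^ p.2 • v m ζ ^ p.1 • x, v m ζ ^ p.2 • y⁆ := by
  rw [IsModuleLieAlgebra.smul_lie_eq (F := F), comul_v_pow, map_sum]
  refine Finset.sum_congr rfl fun p _ => ?_
  rw [map_smul, ← mul_smul]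
  rfl

theorem map_v_pow_smul_lie {S : Type*} [LieRing S] [LieAlgebra F S] {π : L →ₗ⁅F⁆ S}
    (hπ : ∀ x, π (c m ζ • x) = π x) (n : ℕ) (x y : L) : π (v m ζ ^ n • ⁅x, y⁆) =
    ∑ p ∈ antidiagonal n, qPascal ζ n p.2 •
      ⁅π (v m ζ ^ p.1 • x), π (v m ζ ^ p.2 • y)⁆ := by
  simp only [v_pow_smul_lie F, map_sum, map_smul, LieHom.map_lie, map_pow_smul_of_map_smul hπ]

variable (F m ζ L) in
/-- The action of the group-like element `c`, which is an endomorphism of the Lie algebra `L`. -/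
def cLieHom : L →ₗ⁅F⁆ L where
  toFun x := c m ζ • x
  map_add' := smul_add _
  map_smul' _ _ := smul_comm _ _ _
  map_lie' := c_smul_lie F _ _

theorem c_smul_mem_radical [IsNoetherian F L] {x : L} (hx : x ∈ LieAlgebra.radical F L) :
    c m ζ • x ∈ LieAlgebra.radical F L :=
  map_radical_le_radical (f := cLieHom F m ζ L) c_smul_surjective (LieIdeal.mem_map hx)

end ModuleLieAlgebra

variable {F : Type*} [Field F] {m : ℕ} [NeZero m] {ζ : F} [Fact (IsPrimitiveRoot ζ m)]
  {L : Type*} [LieRing L] [LieAlgebra F L] [Module (TaftAlgebra m ζ) L]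
  [IsScalarTower F (TaftAlgebra m ζ) L] [IsModuleLieAlgebra F (TaftAlgebra m ζ) L]

variable (m ζ) in
/-- The ideal `I ∩ v⁻¹(I)`; it is an ideal because `v [x, y] = [c x, v y] + [v x, y]`. -/
def infVPreimage (I : LieIdeal F L) : LieIdeal F L where
  carrier := {x | x ∈ I ∧ v m ζ • x ∈ I}
  add_mem' hx hy := ⟨I.add_mem hx.1 hy.1, by rw [smul_add]; exact I.add_mem hx.2 hy.2⟩
  zero_mem' := ⟨I.zero_mem, by rw [smul_zero]; exact I.zero_mem⟩
  smul_mem' r _ hx := ⟨I.smul_mem r hx.1, by rw [smul_comm]; exact I.smul_mem r hx.2⟩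
  lie_mem hx := ⟨lie_mem_right F L I _ _ hx.1, by
    rw [v_smul_lie F]
    exact I.add_mem (lie_mem_right F L I _ _ hx.2) (lie_mem_right F L I _ _ hx.1)⟩

theorem c_smul_mem_infVPreimage {I : LieIdeal F L} (hI : ∀ x ∈ I, c m ζ • x ∈ I) {x : L}
    (hx : x ∈ infVPreimage m ζ I) : c m ζ • x ∈ infVPreimage m ζ I := by
  refine ⟨hI x hx.1, ?_⟩
  rw [← mul_smul, v_mul_c, smul_assoc, mul_smul]
  exact I.smul_mem ζ (hI _ hx.2)

theorem c_smul_sub_mem_ker {A : LieIdeal F L} (hA : ∀ x ∈ A, c m ζ • x ∈ A)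
    (hbot : infVPreimage m ζ A = ⊥) (x : L) : c m ζ • x - x ∈ LieModule.ker F L A := by
  refine (LieModule.mem_ker F L A _).2 fun ⟨b, hb⟩ => Subtype.ext ?_
  have hmem : ⁅c m ζ • x - x, b⁆ ∈ infVPreimage m ζ A := by
    refine ⟨lie_mem_right F L A _ _ hb, ?_⟩
    rw [v_smul_lie F, smul_sub, c_smul_sub_lie_v_smul F]
    exact A.add_mem (lie_mem_right F L A _ _ (A.sub_mem (hA b hb) hb)) (lie_mem_right F L A _ _ hb)
  rwa [hbot, LieSubmodule.mem_bot] at hmem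

end TaftAlgebra

namespace IsHSimple

section Bialgebra

variable {F H L : Type*} [Field F] [Ring H] [Bialgebra F H] [LieRing L] [LieAlgebra F L]
  [Module H L] [IsScalarTower F H L] [IsModuleLieAlgebra F H L]

theorem derivedSeries_one_eq_top (hs : IsHSimple F H L) :
    LieAlgebra.derivedSeries F L 1 = ⊤ := by
  have hlie : ∀ a b : L, ⁅a, b⁆ ∈ LieAlgebra.derivedSeries F L 1 := fun a b =>
    LieSubmodule.lie_mem_lie (LieSubmodule.mem_top a) (LieSubmodule.mem_top b)
  have htensor : ∀ (a b : L) (t : H ⊗[F] H),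
      tensorBracket a b t ∈ LieAlgebra.derivedSeries F L 1 := by
    intro a b t
    induction t with
    | zero => rw [map_zero]; exact zero_mem _
    | tmul h₁ h₂ => exact hlie (h₁ • a) (h₂ • b)
    | add t₁ t₂ h₁ h₂ => rw [map_add]; exact add_mem h₁ h₂
  refine (hs.eq_bot_or_eq_top _ fun h x hx => ?_).resolve_left fun hbot => ?_
  · replace hx : x ∈ Submodule.span F {x : L | ∃ y z : L, ⁅y, z⁆ = x} :=
      (SetLike.ext_iff.1 (LieAlgebra.coe_derivedSeries_one_eq F L) x).1 hx
    induction hx using Submodule.span_induction with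
    | mem x hx =>
      obtain ⟨a, b, rfl⟩ := hx
      rw [IsModuleLieAlgebra.smul_lie_eq (F := F)]
      exact htensor a b _
    | zero => rw [smul_zero]; exact zero_mem _
    | add x y _ _ hx hy => rw [smul_add]; exact add_mem hx hy
    | smul r x _ hx => rw [smul_comm]; exact SMulMemClass.smul_mem r hx
  · exact hs.non_abelian ⟨fun a b => (LieSubmodule.mem_bot _).1 (hbot ▸ hlie a b)⟩

theorem radical_ne_top [FiniteDimensional F L] (hs : IsHSimple F H L) :
    LieAlgebra.radical F L ≠ ⊤ :=
  have := nontrivial_of_not_isLieAbelian hs.non_abelian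
  radical_ne_top_of_derivedSeries_one_eq_top hs.derivedSeries_one_eq_top

end Bialgebra

section Taft

open TaftAlgebra

variable {F : Type*} [Field F] {m : ℕ} {ζ : F} {L : Type*} [LieRing L] [LieAlgebra F L]
  [Module (TaftAlgebra m ζ) L] [IsScalarTower F (TaftAlgebra m ζ) L]

theorem eq_bot_or_eq_top_of_c_v (hs : IsHSimple F (TaftAlgebra m ζ) L) (I : LieIdeal F L)
    (hc : ∀ x ∈ I, c m ζ • x ∈ I) (hv : ∀ x ∈ I, v m ζ • x ∈ I) : I = ⊥ ∨ I = ⊤ :=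
  hs.eq_bot_or_eq_top I fun h => smul_mem_of_c_v I.toSubmodule hc hv h

variable [NeZero m] [Fact (IsPrimitiveRoot ζ m)] [IsModuleLieAlgebra F (TaftAlgebra m ζ) L]

theorem center_eq_bot (hs : IsHSimple F (TaftAlgebra m ζ) L) : LieAlgebra.center F L = ⊥ := by
  have hc : ∀ x ∈ LieAlgebra.center F L, c m ζ • x ∈ LieAlgebra.center F L := by
    intro x hx y
    obtain ⟨z, rfl⟩ := c_smul_surjective (m := m) (ζ := ζ) y
    rw [← c_smul_lie F, hx z, smul_zero]
  have hv : ∀ x ∈ LieAlgebra.center F L, v m ζ • x ∈ LieAlgebra.center F L := by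
    intro x hx y
    obtain ⟨z, rfl⟩ := c_smul_surjective (m := m) (ζ := ζ) y
    have hz := v_smul_lie F (m := m) (ζ := ζ) z x
    rwa [hx z, hx, smul_zero, add_zero, eq_comm] at hz
  refine (hs.eq_bot_or_eq_top_of_c_v _ hc hv).resolve_right fun htop => ?_
  exact hs.non_abelian ((LieAlgebra.isLieAbelian_iff_center_eq_top F L).2 htop)

theorem ker_ne_top (hs : IsHSimple F (TaftAlgebra m ζ) L) {A : LieIdeal F L} (hA : A ≠ ⊥) :
    LieModule.ker F L A ≠ ⊤ := by
  refine fun htop => hA (eq_bot_iff.2 (hs.center_eq_bot ▸ fun b hb x => ?_))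
  exact congrArg Subtype.val
    ((LieModule.mem_ker F L A _).1 (htop ▸ LieSubmodule.mem_top x) ⟨b, hb⟩)

theorem exists_infVPreimage_eq_bot [FiniteDimensional F L] (hs : IsHSimple F (TaftAlgebra m ζ) L)
    {I : LieIdeal F L} (hI : ∀ x ∈ I, c m ζ • x ∈ I) (hbot : I ≠ ⊥) (htop : I ≠ ⊤) :
    ∃ A : LieIdeal F L, A ≠ ⊥ ∧ (∀ x ∈ A, c m ζ • x ∈ A) ∧ infVPreimage m ζ A = ⊥ := by
  obtain ⟨A, ⟨hA, hAbot, hAI⟩, hmin⟩ := (LieSubmodule.wellFoundedLT_of_isArtinian F L L).wf.has_min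
    {A : LieIdeal F L | (∀ x ∈ A, c m ζ • x ∈ A) ∧ A ≠ ⊥ ∧ A ≤ I} ⟨I, hI, hbot, le_rfl⟩
  refine ⟨A, hAbot, hA, ?_⟩
  by_contra hne
  have hle : infVPreimage m ζ A ≤ A := fun _ hx => hx.1
  have hAv : infVPreimage m ζ A = A := by
    refine hle.eq_of_not_lt (hmin _ ⟨fun _ => c_smul_mem_infVPreimage hA, hne, hle.trans hAI⟩)
  refine (hs.eq_bot_or_eq_top_of_c_v A hA fun x hx => ?_).elim hAbot fun h => ?_
  · exact (hAv.symm ▸ hx : x ∈ infVPreimage m ζ A).2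
  · exact htop (top_le_iff.1 (h ▸ hAI))

theorem exists_isSimple_map_c_smul_eq {L : Type w} [LieRing L] [LieAlgebra F L]
    [Module (TaftAlgebra m ζ) L] [IsScalarTower F (TaftAlgebra m ζ) L]
    [IsModuleLieAlgebra F (TaftAlgebra m ζ) L] [FiniteDimensional F L]
    (hs : IsHSimple F (TaftAlgebra m ζ) L) {I : LieIdeal F L} (hI : ∀ x ∈ I, c m ζ • x ∈ I)
    (hbot : I ≠ ⊥) (htop : I ≠ ⊤) :
    ∃ (B : Type w) (_ : LieRing B) (_ : LieAlgebra F B) (π : L →ₗ⁅F⁆ B),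
      LieAlgebra.IsSimple F B ∧ Function.Surjective π ∧ ∀ x, π (c m ζ • x) = π x := by
  obtain ⟨A, hAbot, hA, hAv⟩ := hs.exists_infVPreimage_eq_bot hI hbot htop
  obtain ⟨K, hK, hAK⟩ := (eq_top_or_exists_le_coatom _).resolve_left (hs.ker_ne_top hAbot)
  refine ⟨L ⧸ K, inferInstance, inferInstance, lieQuotientMap K,
    isSimple_quotient_of_isCoatom hs.derivedSeries_one_eq_top hK, lieQuotientMap_surjective K,
    fun x => ?_⟩
  rw [← sub_eq_zero, ← map_sub, lieQuotientMap_eq_zero_iff]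
  exact hAK (c_smul_sub_mem_ker hA hAv x)

end Taft

end IsHSimple

namespace TaftAlgebra

section VOrder

variable {F : Type*} [Field F] {m : ℕ} {ζ : F} {L : Type*} [LieRing L] [LieAlgebra F L]
  [Module (TaftAlgebra m ζ) L] [IsScalarTower F (TaftAlgebra m ζ) L] {S : Type*} [LieRing S]
  [LieAlgebra F S] {π : L →ₗ⁅F⁆ S}

theorem map_v_pow_smul_c_smul (hπ : ∀ x, π (c m ζ • x) = π x) (n : ℕ) (x : L) :
    π (v m ζ ^ n • c m ζ • x) = ζ ^ n • π (v m ζ ^ n • x) := by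
  rw [← mul_smul, v_pow_mul_c, smul_assoc, map_smul, mul_smul, hπ]

variable [hζ : Fact (IsPrimitiveRoot ζ m)]

theorem map_v_pow_smul_eq_zero_of_c_smul_eq_self (hπ : ∀ x, π (c m ζ • x) = π x) {x : L}
    (hx : c m ζ • x = x) {n : ℕ} (hn : n ≠ 0) : π (v m ζ ^ n • x) = 0 := by
  rcases le_or_gt m n with hmn | hnm
  · rw [v_pow_smul_eq_zero hmn, map_zero]
  have heigen := map_v_pow_smul_c_smul hπ n x
  rw [hx] at heigen
  by_contra hne
  exact hζ.out.pow_ne_one_of_pos_of_lt hn hnm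
    (smul_left_injective F hne (heigen.symm.trans (one_smul F _).symm))

variable [NeZero m] [IsModuleLieAlgebra F (TaftAlgebra m ζ) L]

theorem map_v_pow_smul_lie_eq_zero (hπ : ∀ x, π (c m ζ • x) = π x) {k l n : ℕ} {x y : L}
    (hx : ∀ i < k, π (v m ζ ^ i • x) = 0) (hy : ∀ j < l, π (v m ζ ^ j • y) = 0)
    (hn : n < k + l) : π (v m ζ ^ n • ⁅x, y⁆) = 0 := by
  rw [map_v_pow_smul_lie hπ]
  refine Finset.sum_eq_zero fun p hp => ?_
  rw [Finset.HasAntidiagonal.mem_antidiagonal] at hp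
  obtain hk | hl : p.1 < k ∨ p.2 < l := by omega
  · rw [hx _ hk, zero_lie, smul_zero]
  · rw [hy _ hl, lie_zero, smul_zero]

theorem map_v_pow_smul_lie_eq_smul_lie (hπ : ∀ x, π (c m ζ • x) = π x) {k l : ℕ} {x y : L}
    (hx : ∀ i < k, π (v m ζ ^ i • x) = 0) (hy : ∀ j < l, π (v m ζ ^ j • y) = 0) :
    π (v m ζ ^ (k + l) • ⁅x, y⁆) =
      qPascal ζ (k + l) l • ⁅π (v m ζ ^ k • x), π (v m ζ ^ l • y)⁆ := by
  rw [map_v_pow_smul_lie hπ]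
  refine Finset.sum_eq_single (k, l) (fun p hp hne => ?_) fun h => ?_
  · rw [Finset.HasAntidiagonal.mem_antidiagonal] at hp
    obtain hk | hl : p.1 < k ∨ p.2 < l := by
      by_contra! hle
      exact hne (Prod.ext (by omega) (by omega))
    · rw [hx _ hk, zero_lie, smul_zero]
    · rw [hy _ hl, lie_zero, smul_zero]
  · exact (h (Finset.HasAntidiagonal.mem_antidiagonal.2 rfl)).elim

variable (π) in
/-- The elements of order at least `k`: those `x` with `π (vⁿ x) = 0` for all `n < k`. By the
quantum Leibniz rule these ideals form a multiplicative filtration of `L`. -/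
def vOrderIdeal (hπ : ∀ x, π (c m ζ • x) = π x) (k : ℕ) : LieIdeal F L where
  carrier := {x | ∀ n < k, π (v m ζ ^ n • x) = 0}
  add_mem' hx hy n hn := by rw [smul_add, map_add, hx n hn, hy n hn, add_zero]
  zero_mem' n _ := by rw [smul_zero, map_zero]
  smul_mem' r x hx n hn := by rw [smul_comm, map_smul, hx n hn, smul_zero]
  lie_mem hy n hn := map_v_pow_smul_lie_eq_zero hπ (k := 0)
    (fun _ h => absurd h (Nat.not_lt_zero _)) hy ((zero_add k).symm ▸ hn)

variable (hπ : ∀ x, π (c m ζ • x) = π x)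

theorem vOrderIdeal_zero : vOrderIdeal π hπ 0 = ⊤ :=
  top_le_iff.1 fun _ _ _ hn => absurd hn (Nat.not_lt_zero _)

theorem vOrderIdeal_one : vOrderIdeal π hπ 1 = π.ker := by
  ext x
  rw [LieHom.mem_ker]
  refine ⟨fun hx => by simpa only [pow_zero, one_smul] using hx 0 one_pos, fun hx n hn => ?_⟩
  rw [Nat.lt_one_iff.1 hn, pow_zero, one_smul, hx]

theorem vOrderIdeal_eq_bot (hs : IsHSimple F (TaftAlgebra m ζ) L) (hker : π.ker ≠ ⊤) :
    vOrderIdeal π hπ m = ⊥ := by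
  refine (hs.eq_bot_or_eq_top_of_c_v _ ?_ ?_).resolve_right fun htop => hker ?_
  · intro x hx n hn
    rw [map_v_pow_smul_c_smul hπ, hx n hn, smul_zero]
  · intro x hx n _
    rw [← mul_smul, ← pow_succ]
    rcases Nat.lt_or_ge (n + 1) m with hlt | hge
    · exact hx _ hlt
    · rw [v_pow_smul_eq_zero hge, map_zero]
  · rw [eq_top_iff, ← htop, ← vOrderIdeal_one hπ]
    exact fun x hx n hn => hx n (hn.trans_le (NeZero.pos m))

include hπ

theorem isNilpotent_ker (hs : IsHSimple F (TaftAlgebra m ζ) L) (hker : π.ker ≠ ⊤) :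
    LieRing.IsNilpotent π.ker := by
  refine isNilpotent_of_lie_le (vOrderIdeal π hπ) (vOrderIdeal_zero hπ) (fun k => ?_)
    (vOrderIdeal_eq_bot hπ hs hker)
  refine (LieSubmodule.lie_le_iff _ _ _).2 fun x hx y hy n hn => ?_
  rw [← vOrderIdeal_one hπ] at hx
  exact map_v_pow_smul_lie_eq_zero hπ hx hy (add_comm k 1 ▸ hn)

theorem eq_zero_of_map_v_pow_smul_eq_zero (hs : IsHSimple F (TaftAlgebra m ζ) L)
    (hker : π.ker ≠ ⊤) {x : L} (hx : ∀ n < m, π (v m ζ ^ n • x) = 0) : x = 0 := by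
  rwa [← LieSubmodule.mem_bot (R := F) (L := L) x, ← vOrderIdeal_eq_bot hπ hs hker]

theorem v_smul_eq_zero_iff_mem_degreeZero (hs : IsHSimple F (TaftAlgebra m ζ) L)
    (hker : π.ker ≠ ⊤) (x : L) : v m ζ • x = 0 ↔ x ∈ degreeZero m ζ L := by
  constructor
  · intro hv
    refine sub_eq_zero.1 (eq_zero_of_map_v_pow_smul_eq_zero hπ hs hker fun n _ => ?_)
    rw [smul_sub, map_sub, map_v_pow_smul_c_smul hπ]
    cases n with
    | zero => rw [pow_zero, one_smul, sub_self]
    | succ n => rw [pow_succ (v m ζ), mul_smul, hv, smul_zero, map_zero, smul_zero, sub_self]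
  · intro hx
    refine eq_zero_of_map_v_pow_smul_eq_zero hπ hs hker fun n _ => ?_
    rw [← mul_smul, ← pow_succ]
    exact map_v_pow_smul_eq_zero_of_c_smul_eq_self hπ hx n.succ_ne_zero

theorem bijective_comp_incl_degreeZero (hs : IsHSimple F (TaftAlgebra m ζ) L)
    (hker : π.ker ≠ ⊤) (hsurj : Function.Surjective π) :
    Function.Bijective (π.comp (degreeZero m ζ L).incl) := by
  refine ⟨(injective_iff_map_eq_zero _).2 fun x hx => Subtype.ext ?_, fun s => ?_⟩
  · refine eq_zero_of_map_v_pow_smul_eq_zero hπ hs hker fun n _ => ?_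
    cases n with
    | zero => rw [pow_zero, one_smul]; exact hx
    | succ n => exact map_v_pow_smul_eq_zero_of_c_smul_eq_self hπ x.2 n.succ_ne_zero
  · obtain ⟨x, rfl⟩ := hsurj s
    obtain ⟨y, hy, hyx⟩ := exists_smul_eq_self_and_map_eq (c_pow m ζ)
      hζ.out.neZero'.out (π : L →ₗ[F] S) hπ x
    exact ⟨⟨y, hy⟩, hyx⟩

end VOrder

end TaftAlgebra

namespace TaftLie

variable {F : Type*} [Field F] {m : ℕ} {ζ : F}

theorem coeff_gamma_zero (hζ : IsPrimitiveRoot ζ m) (k l i : Fin m) :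
    coeff ζ 0 k l i = if (k : ℕ) + l = i then qPascal ζ i l else 0 := by
  unfold coeff
  split_ifs with h
  · rw [← h, qPascal_eq_qBinom hζ k.2 l.2]
  · exact zero_mul _
  · rfl

theorem lie_apply_eq_sum_antidiagonal {S : Type*} [LieRing S] [LieAlgebra F S]
    (hζ : IsPrimitiveRoot ζ m) (a b : ℕ → S) (i : Fin m) :
    ⁅(⟨fun k => a k⟩ : TaftLie m ζ S (0 : F)), (⟨fun l => b l⟩ : TaftLie m ζ S (0 : F))⁆ i =
      ∑ p ∈ antidiagonal (i : ℕ), qPascal ζ i p.2 • ⁅a p.1, b p.2⁆ := by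
  have hsub : antidiagonal (i : ℕ) ⊆ Finset.range m ×ˢ Finset.range m := by
    intro p hp
    have hi := i.2
    rw [Finset.HasAntidiagonal.mem_antidiagonal] at hp
    rw [Finset.mem_product, Finset.mem_range, Finset.mem_range]
    omega
  calc
    _ = ∑ k : Fin m, ∑ l : Fin m,
        (if (k : ℕ) + l = i then qPascal ζ i l else 0) • ⁅a k, b l⁆ := by
      simp only [lie_apply, coeff_gamma_zero hζ]
    _ = ∑ p ∈ Finset.range m ×ˢ Finset.range m,
        (if p.1 + p.2 = i then qPascal ζ i p.2 else 0) • ⁅a p.1, b p.2⁆ := by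
      rw [Finset.sum_product, ← Fin.sum_univ_eq_sum_range]
      refine Finset.sum_congr rfl fun k _ => ?_
      rw [← Fin.sum_univ_eq_sum_range]
    _ = ∑ p ∈ antidiagonal (i : ℕ),
        (if p.1 + p.2 = i then qPascal ζ i p.2 else 0) • ⁅a p.1, b p.2⁆ := by
      refine (Finset.sum_subset hsub fun p _ hp => ?_).symm
      rw [if_neg fun h => hp (Finset.HasAntidiagonal.mem_antidiagonal.2 h), zero_smul]
    _ = _ := Finset.sum_congr rfl fun p hp => by
      rw [if_pos (Finset.HasAntidiagonal.mem_antidiagonal.1 hp)]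

end TaftLie

namespace TaftAlgebra

variable {F : Type*} [Field F] {m : ℕ} [NeZero m] {ζ : F} [hζ : Fact (IsPrimitiveRoot ζ m)]
  {L : Type*} [LieRing L] [LieAlgebra F L] [Module (TaftAlgebra m ζ) L]
  [IsScalarTower F (TaftAlgebra m ζ) L] [IsModuleLieAlgebra F (TaftAlgebra m ζ) L]
  {S : Type*} [LieRing S] [LieAlgebra F S] {π : L →ₗ⁅F⁆ S}

section LeadingCoeffs

variable (π) in
/-- The leading coefficients `π (vᵏ x)` of the elements `x` of order at least `k`, that is, the
image in `S` of the `k`-th graded piece of the filtration `vOrderIdeal π hπ`. -/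
def leadingCoeffs (hπ : ∀ x, π (c m ζ • x) = π x) (k : ℕ) : Submodule F S :=
  (vOrderIdeal π hπ k).toSubmodule.map
    ((π : L →ₗ[F] S).comp (DistribSMul.toLinearMap F L (v m ζ ^ k)))

variable (hπ : ∀ x, π (c m ζ • x) = π x)

theorem mem_leadingCoeffs {k : ℕ} {s : S} :
    s ∈ leadingCoeffs π hπ k ↔ ∃ x ∈ vOrderIdeal π hπ k, π (v m ζ ^ k • x) = s :=
  Iff.rfl

theorem qPascal_smul_lie_mem_leadingCoeffs {k l : ℕ} {s t : S} (hs : s ∈ leadingCoeffs π hπ k)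
    (ht : t ∈ leadingCoeffs π hπ l) :
    qPascal ζ (k + l) l • ⁅s, t⁆ ∈ leadingCoeffs π hπ (k + l) := by
  obtain ⟨x, hx, rfl⟩ := (mem_leadingCoeffs hπ).1 hs
  obtain ⟨y, hy, rfl⟩ := (mem_leadingCoeffs hπ).1 ht
  exact (mem_leadingCoeffs hπ).2 ⟨⁅x, y⁆, fun _ => map_v_pow_smul_lie_eq_zero hπ hx hy,
    map_v_pow_smul_lie_eq_smul_lie hπ hx hy⟩

theorem leadingCoeffs_zero (hsurj : Function.Surjective π) : leadingCoeffs π hπ 0 = ⊤ := by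
  refine top_le_iff.1 fun s _ => ?_
  obtain ⟨x, rfl⟩ := hsurj s
  refine (mem_leadingCoeffs hπ).2 ⟨x, vOrderIdeal_zero hπ ▸ LieSubmodule.mem_top x, ?_⟩
  rw [pow_zero, one_smul]

theorem leadingCoeffs_eq_bot_or_eq_top [LieAlgebra.IsSimple F S]
    (hsurj : Function.Surjective π) (k : ℕ) :
    leadingCoeffs π hπ k = ⊥ ∨ leadingCoeffs π hπ k = ⊤ := by
  let I : LieIdeal F S :=
    { leadingCoeffs π hπ k with
      lie_mem := fun {s t} ht => by
        have hs : s ∈ leadingCoeffs π hπ 0 := leadingCoeffs_zero hπ hsurj ▸ Submodule.mem_top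
        have hlie := qPascal_smul_lie_mem_leadingCoeffs hπ ht hs
        rw [qPascal_zero_right, one_smul, ← lie_skew] at hlie
        exact neg_mem_iff.1 hlie }
  exact (LieAlgebra.IsSimple.eq_bot_or_eq_top I).imp
    (congrArg LieSubmodule.toSubmodule) (congrArg LieSubmodule.toSubmodule)

theorem leadingCoeffs_one_ne_bot (hs : IsHSimple F (TaftAlgebra m ζ) L) (hbot : π.ker ≠ ⊥)
    (htop : π.ker ≠ ⊤) : leadingCoeffs π hπ 1 ≠ ⊥ := by
  intro h
  refine (hs.eq_bot_or_eq_top_of_c_v π.ker (fun x hx => ?_) fun x hx => ?_).elim hbot htop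
  · rwa [LieHom.mem_ker, hπ]
  · rw [LieHom.mem_ker, ← Submodule.mem_bot F, ← h]
    refine (mem_leadingCoeffs hπ).2 ⟨x, (vOrderIdeal_one hπ).symm ▸ hx, ?_⟩
    rw [pow_one]

theorem leadingCoeffs_eq_top [LieAlgebra.IsSimple F S] (hs : IsHSimple F (TaftAlgebra m ζ) L)
    (hsurj : Function.Surjective π) (hbot : π.ker ≠ ⊥) (htop : π.ker ≠ ⊤) {k : ℕ} (hk : k < m) :
    leadingCoeffs π hπ k = ⊤ := by
  induction k with
  | zero => exact leadingCoeffs_zero hπ hsurj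
  | succ k ih =>
    refine (leadingCoeffs_eq_bot_or_eq_top hπ hsurj _).resolve_left fun h => ?_
    have hone := (leadingCoeffs_eq_bot_or_eq_top hπ hsurj 1).resolve_left
      (leadingCoeffs_one_ne_bot hπ hs hbot htop)
    refine LieAlgebra.IsSimple.non_abelian F (L := S) ⟨fun s t => ?_⟩
    have hlie := qPascal_smul_lie_mem_leadingCoeffs hπ
      (ih (by omega) ▸ Submodule.mem_top : s ∈ _) (hone ▸ Submodule.mem_top : t ∈ _)
    rw [h, Submodule.mem_bot] at hlie
    exact (smul_eq_zero.1 hlie).resolve_left (qPascal_ne_zero hζ.out hk)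

end LeadingCoeffs

section CoordHom

variable (π) in
/-- The morphism `L → L(S, 0)` induced by a `c`-invariant morphism `π : L → S`; its components
are `x ↦ π (vⁱ x)`. -/
def coordHom (hπ : ∀ x, π (c m ζ • x) = π x) : L →ₗ⁅F⁆ TaftLie m ζ S (0 : F) where
  toFun x := ⟨fun i => π (v m ζ ^ (i : ℕ) • x)⟩
  map_add' x y := TaftLie.ext_apply fun i => by
    simp only [TaftLie.add_apply, smul_add, map_add]
  map_smul' r x := TaftLie.ext_apply fun i => by
    simp only [TaftLie.smul_apply, smul_comm _ r, map_smul, RingHom.id_apply]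
  map_lie' {x y} := TaftLie.ext_apply fun i => by
    refine (map_v_pow_smul_lie hπ i x y).trans (Eq.symm ?_)
    exact TaftLie.lie_apply_eq_sum_antidiagonal hζ.out (fun n => π (v m ζ ^ n • x))
      (fun n => π (v m ζ ^ n • y)) i

variable (hπ : ∀ x, π (c m ζ • x) = π x)

theorem coordHom_apply (x : L) (i : Fin m) :
    coordHom π hπ x i = π (v m ζ ^ (i : ℕ) • x) := rfl

theorem coordHom_smul (h : TaftAlgebra m ζ) (x : L) :
    coordHom π hπ (h • x) = h • coordHom π hπ x := by
  have hc (x : L) : coordHom π hπ (c m ζ • x) = c m ζ • coordHom π hπ x := by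
    refine TaftLie.ext_apply fun i => ?_
    rw [TaftLie.c_smul_apply, coordHom_apply, coordHom_apply, map_v_pow_smul_c_smul hπ]
  have hv (x : L) : coordHom π hπ (v m ζ • x) = v m ζ • coordHom π hπ x := by
    refine TaftLie.ext_apply fun i => ?_
    rw [TaftLie.v_smul_apply, coordHom_apply, ← mul_smul, ← pow_succ]
    split_ifs with hi
    · rfl
    · rw [v_pow_smul_eq_zero (not_lt.1 hi), map_zero]
  exact map_smul_of_c_v (coordHom π hπ : L →ₗ[F] TaftLie m ζ S (0 : F)) hc hv h x

theorem coordHom_injective (hs : IsHSimple F (TaftAlgebra m ζ) L) (hker : π.ker ≠ ⊤) :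
    Function.Injective (coordHom π hπ) :=
  (injective_iff_map_eq_zero _).2 fun _ hx =>
    eq_zero_of_map_v_pow_smul_eq_zero hπ hs hker fun n hn =>
      congrArg (fun f : TaftLie m ζ S (0 : F) => f ⟨n, hn⟩) hx

theorem coordHom_surjective [LieAlgebra.IsSimple F S] (hs : IsHSimple F (TaftAlgebra m ζ) L)
    (hsurj : Function.Surjective π) (hbot : π.ker ≠ ⊥) (htop : π.ker ≠ ⊤) :
    Function.Surjective (coordHom π hπ) := by
  intro f
  have happrox : ∀ k ≤ m, ∃ x, ∀ i : Fin m, (i : ℕ) < k → coordHom π hπ x i = f i := by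
    intro k hk
    induction k with
    | zero => exact ⟨0, fun i hi => absurd hi (Nat.not_lt_zero _)⟩
    | succ k ih =>
      obtain ⟨x, hx⟩ := ih (by omega)
      have hlead := leadingCoeffs_eq_top hπ hs hsurj hbot htop hk
      obtain ⟨y, hy, hyk⟩ := (mem_leadingCoeffs hπ).1
        (hlead ▸ Submodule.mem_top : f ⟨k, hk⟩ - coordHom π hπ x ⟨k, hk⟩ ∈ leadingCoeffs π hπ k)
      refine ⟨x + y, fun i hi => ?_⟩
      rw [map_add, TaftLie.add_apply, coordHom_apply hπ y]
      obtain hik | hik := Nat.lt_succ_iff_lt_or_eq.1 hi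
      · rw [hx i hik, hy i hik, add_zero]
      · obtain rfl : i = ⟨k, hk⟩ := Fin.ext hik
        rw [hyk, add_sub_cancel]
  obtain ⟨x, hx⟩ := happrox m le_rfl
  exact ⟨x, TaftLie.ext_apply fun i => hx i i.2⟩

end CoordHom

end TaftAlgebra

open TaftAlgebra in
theorem mainTheorem1_general {F : Type u} [Field F] (m : ℕ) [NeZero m] (ζ : F)
    [Fact (IsPrimitiveRoot ζ m)] {L : Type w} [LieRing L] [LieAlgebra F L]
    [FiniteDimensional F L] [Module (TaftAlgebra m ζ) L] [IsScalarTower F (TaftAlgebra m ζ) L]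
    [IsModuleLieAlgebra F (TaftAlgebra m ζ) L] (hsimple : IsHSimple F (TaftAlgebra m ζ) L)
    (hrad : LieAlgebra.radical F L ≠ ⊥) :
    (∃ (B : Type w) (_ : LieRing B) (_ : LieAlgebra F B),
      FiniteDimensional F B ∧ LieAlgebra.IsSimple F B ∧
      (∃ e : L ≃ₗ⁅F⁆ TaftLie m ζ B (0 : F),
        ∀ (h : TaftAlgebra m ζ) (x : L), e (h • x) = h • e x) ∧
      Nonempty (degreeZero m ζ L ≃ₗ⁅F⁆ B)) ∧
    LieAlgebra.radical F L = lieNilradical F L ∧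
    (∀ x : L, v m ζ • x = 0 ↔ x ∈ degreeZero m ζ L) := by
  obtain ⟨B, _, _, π, hB, hsurj, hπ⟩ := hsimple.exists_isSimple_map_c_smul_eq
    (fun _ => c_smul_mem_radical) hrad hsimple.radical_ne_top
  have hbot : π.ker ≠ ⊥ := fun h => hrad (le_bot_iff.1 ((radical_le_ker hsurj).trans_eq h))
  have htop : π.ker ≠ ⊤ :=
    have := nontrivial_of_not_isLieAbelian hB.non_abelian
    ker_ne_top_of_surjective hsurj
  refine ⟨⟨B, _, _, Module.Finite.of_surjective (π : L →ₗ[F] B) hsurj, hB, ?_, ?_⟩, ?_, ?_⟩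
  · exact ⟨LieEquiv.ofBijective (coordHom π hπ) ⟨coordHom_injective hπ hsimple htop,
      coordHom_surjective hπ hsimple hsurj hbot htop⟩, coordHom_smul hπ⟩
  · exact ⟨LieEquiv.ofBijective _ (bijective_comp_incl_degreeZero hπ hsimple htop hsurj)⟩
  · exact radical_eq_lieNilradical_of_isNilpotent_ker hsurj (isNilpotent_ker hπ hsimple htop)
  · exact v_smul_eq_zero_iff_mem_degreeZero hπ hsimple htop

theorem mainTheorem1 {F : Type u} [Field F] [IsAlgClosed F] [CharZero F]
    (m : ℕ) [NeZero m] (hm : 2 ≤ m) (ζ : F) [Fact (IsPrimitiveRoot ζ m)]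
    {L : Type w} [LieRing L] [LieAlgebra F L] [FiniteDimensional F L]
    [Module (TaftAlgebra m ζ) L] [IsScalarTower F (TaftAlgebra m ζ) L]
    [IsModuleLieAlgebra F (TaftAlgebra m ζ) L]
    (hsimple : IsHSimple F (TaftAlgebra m ζ) L)
    (hrad : LieAlgebra.radical F L ≠ ⊥) :
    (∃ (B : Type w) (_ : LieRing B) (_ : LieAlgebra F B),
      FiniteDimensional F B ∧ LieAlgebra.IsSimple F B ∧
      (∃ e : L ≃ₗ⁅F⁆ TaftLie m ζ B (0 : F),
        ∀ (h : TaftAlgebra m ζ) (x : L), e (h • x) = h • e x) ∧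
      Nonempty (TaftAlgebra.degreeZero m ζ L ≃ₗ⁅F⁆ B)) ∧
    LieAlgebra.radical F L = lieNilradical F L ∧
    (∀ x : L, TaftAlgebra.v m ζ • x = 0 ↔ x ∈ TaftAlgebra.degreeZero m ζ L) :=
  mainTheorem1_general m ζ hsimple hrad
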